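/- Terminology. Write $2^\kappa$ for the product of $\kappa$ copies of the discrete two-point space. A topological space $X$ is \emph{$D$-separable} (respectively, \emph{$NWD$-separable}) if for every sequence $(D_n)_{n<\omega}$ of dense subsets of $X$ there are sets $E_n\subseteq D_n$, each discrete in the subspace topology (respectively, each nowhere dense in $X$), such that $\bigcup_{n<\omega}E_n$ is dense in $X$. Let $\mathrm{cof}(\mathcal M)$ be the least cardinality of a family of meager subsets of $\mathbb R$ such that every meager subset of $\mathbb R$ is contained in a member of the family, and let $$\mathfrak{cds}=\min\{\kappa : 2^\kappa \text{ contains a countable subspace that is not $D$-separable}\}.$$ Theorem. Assume $\mathrm{cof}(\mathcal M)=\omega_1$. Then $2^{\omega_1}$ has a countable dense subspace that is not $NWD$-separable. Consequently $\mathfrak{cds}=\omega_1$; in particular, if moreover $\omega_1<2^{\omega}$, then $\mathfrak{cds}<2^{\omega}$. -/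

import Mathlib

open Cardinal Ordinal

/-- A space is `D`-separable if from every sequence of dense sets one can choose discrete subsets
(discrete in the subspace topology) whose union is dense. -/
def DSeparable (X : Type*) [TopologicalSpace X] : Prop :=
  ∀ D : ℕ → Set X, (∀ n, Dense (D n)) →
    ∃ E : ℕ → Set X, (∀ n, E n ⊆ D n ∧ IsDiscrete (E n)) ∧ Dense (⋃ n, E n)

/-- A space is `NWD`-separable if from every sequence of dense sets one can choose nowhere dense
subsets whose union is dense. -/
def NWDSeparable (X : Type*) [TopologicalSpace X] : Prop :=
  ∀ D : ℕ → Set X, (∀ n, Dense (D n)) →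
    ∃ E : ℕ → Set X, (∀ n, E n ⊆ D n ∧ IsNowhereDense (E n)) ∧ Dense (⋃ n, E n)

/-- `cof(𝓜)`: the least cardinality of a family of meagre sets of reals such that every meagre
set of reals is contained in a member of the family. -/
noncomputable def cofMeagre : Cardinal.{0} :=
  Order.cof {A : Set ℝ // IsMeagre A}

/-- The cardinals `κ` such that `2^κ` contains a countable subspace that is not `D`-separable
(`2 = Bool` is discrete and `2^κ` carries the product topology). -/
def cdsSet : Set Cardinal.{0} :=
  {κ | ∃ I : Type, #I = κ ∧ ∃ X : Set (I → Bool), X.Countable ∧ ¬ DSeparable X}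

/-- `𝔠𝔡𝔰 = min {κ : 2^κ contains a countable non-D-separable subspace}`. -/
noncomputable def cds : Cardinal.{0} := sInf cdsSet

/-! By recursion on α < ω₁, sets A_α ⊆ ω × ω are built whose finite consistent Boolean combinations
all meet every column {n} × ω in an infinite set. Recording memberships (`cubePoint`) turns every
column into a dense subset of 2^ω₁; the range is the required space and the columns are the sequence
that defeats NWD-separability. If E_n is a nowhere dense part of the n-th column, then closing off
(`exists_closed_below`) gives an α < ω₁ such that all E_n are already nowhere dense for the
coordinates below α. It is therefore enough that some A_β misses E_n in column n for every n: the
nonempty open set {y : y_β = 1} then misses every E_n.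

There can be more such sequences than stages, so ω₁ of them must suffice. For each α, cof(M) = ω₁
yields ω₁ sequences (F_n) that are cofinal, under termwise inclusion, among sequences of sets
nowhere dense below α (`exists_cofinal_nwdBelow`). This rests on `IsMeagreBase.exists_guessing`: the
conditions below α form a countable preorder, a bit sequence outside a suitable meagre set steers a
descending walk into prescribed dense sets, and a dominating family of size at most cof(M) bounds
the waiting times. Bookkeeping treats each F at some stage β ≥ α, where A_β is a splitting set with
F_n removed from column n; nowhere density of F_n preserves independence (`exists_isGoodStep`).

For cds: if κ is countable, 2^κ is second countable and its subspaces are D-separable. In a dense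
subspace of 2^ω₁ no point is isolated, so discrete sets are nowhere dense and D-separability would
imply NWD-separability. -/

/-! ### Uniqueness of binary expansions. -/

theorem ofDigits_two_succ (a : ℕ → Fin 2) :
    2 * Real.ofDigits a = (a 0 : ℕ) + Real.ofDigits (fun i ↦ a (i + 1)) := by
  have h := Real.ofDigits_eq_sum_add_ofDigits a 1
  simp only [Finset.range_one, Finset.sum_singleton, Real.ofDigitsTerm] at h
  rw [h]
  norm_num
  ring

theorem eq_zero_of_ofDigits_eq_zero {a : ℕ → Fin 2} (h : Real.ofDigits a = 0) (k : ℕ) :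
    a k = 0 := by
  induction k generalizing a with
  | zero =>
    have h1 := ofDigits_two_succ a
    have h2 := Real.ofDigits_nonneg (fun i ↦ a (i + 1))
    have h3 : ((a 0 : ℕ) : ℝ) ≤ 0 := by linarith
    have h4 : (a 0 : ℕ) ≤ 0 := by exact_mod_cast h3
    omega
  | succ k ih =>
    have h1 := ofDigits_two_succ a
    have h2 := Real.ofDigits_nonneg (fun i ↦ a (i + 1))
    have h3 : (0 : ℝ) ≤ ((a 0 : ℕ) : ℝ) := by positivity
    exact ih (a := fun i ↦ a (i + 1)) (by linarith)

theorem eq_one_of_ofDigits_eq_one {a : ℕ → Fin 2} (h : Real.ofDigits a = 1) (k : ℕ) :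
    a k = 1 := by
  induction k generalizing a with
  | zero =>
    have h1 := ofDigits_two_succ a
    have h2 := Real.ofDigits_le_one (fun i ↦ a (i + 1))
    have h3 : (1 : ℝ) ≤ ((a 0 : ℕ) : ℝ) := by linarith
    have h4 : 1 ≤ (a 0 : ℕ) := by exact_mod_cast h3
    omega
  | succ k ih =>
    have h1 := ofDigits_two_succ a
    have h2 := Real.ofDigits_le_one (fun i ↦ a (i + 1))
    have h3 : ((a 0 : ℕ) : ℝ) ≤ 1 := by
      have : (a 0 : ℕ) ≤ 1 := by omega
      exact_mod_cast this
    exact ih (a := fun i ↦ a (i + 1)) (by linarith)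

/-- A nonconstant tail of `a` has value strictly between 0 and 1, while that of `b` lies in [0, 1],
so the leading digits differ by less than 1. -/
theorem head_eq_of_ofDigits_eq {a b : ℕ → Fin 2} (h0 : ∃ i ≥ 1, a i = 0)
    (h1 : ∃ i ≥ 1, a i = 1) (h : Real.ofDigits a = Real.ofDigits b) : a 0 = b 0 := by
  have ha := ofDigits_two_succ a
  have hb := ofDigits_two_succ b
  have hb0 := Real.ofDigits_nonneg (fun i ↦ b (i + 1))
  have hb1 := Real.ofDigits_le_one (fun i ↦ b (i + 1))
  have ha0 : 0 < Real.ofDigits (fun i ↦ a (i + 1)) := by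
    refine (Real.ofDigits_nonneg _).lt_of_ne' fun h ↦ ?_
    obtain ⟨i, hi, hi'⟩ := h1
    have := eq_zero_of_ofDigits_eq_zero h (i - 1)
    rw [Nat.sub_add_cancel hi] at this
    simp [this] at hi'
  have ha1 : Real.ofDigits (fun i ↦ a (i + 1)) < 1 := by
    refine (Real.ofDigits_le_one _).lt_of_ne fun h ↦ ?_
    obtain ⟨i, hi, hi'⟩ := h0
    have := eq_one_of_ofDigits_eq_one h (i - 1)
    rw [Nat.sub_add_cancel hi] at this
    simp [this] at hi'
  have l1 : ((a 0 : ℕ) : ℝ) < (b 0 : ℕ) + 1 := by linarith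
  have l2 : ((b 0 : ℕ) : ℝ) < (a 0 : ℕ) + 1 := by linarith
  have l1' : (a 0 : ℕ) < (b 0 : ℕ) + 1 := by exact_mod_cast l1
  have l2' : (b 0 : ℕ) < (a 0 : ℕ) + 1 := by exact_mod_cast l2
  omega

/-- A binary expansion with infinitely many zeros and infinitely many ones is unique. -/
theorem eq_of_ofDigits_eq {a b : ℕ → Fin 2} (h0 : ∀ n, ∃ i ≥ n, a i = 0)
    (h1 : ∀ n, ∃ i ≥ n, a i = 1) (h : Real.ofDigits a = Real.ofDigits b) (k : ℕ) :
    a k = b k := by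
  induction k generalizing a b with
  | zero =>
    exact head_eq_of_ofDigits_eq (h0 1) (h1 1) h
  | succ k ih =>
    have hz := head_eq_of_ofDigits_eq (h0 1) (h1 1) h
    refine ih (a := fun i ↦ a (i + 1)) (b := fun i ↦ b (i + 1)) ?_ ?_ ?_
    · intro n
      obtain ⟨i, hi, hi'⟩ := h0 (n + 1)
      exact ⟨i - 1, by omega, by rw [Nat.sub_add_cancel (by omega)]; exact hi'⟩
    · intro n
      obtain ⟨i, hi, hi'⟩ := h1 (n + 1)
      exact ⟨i - 1, by omega, by rw [Nat.sub_add_cancel (by omega)]; exact hi'⟩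
    · have ha := ofDigits_two_succ a
      have hb := ofDigits_two_succ b
      rw [h, hz] at ha
      linarith

/-! ### Transfer of meagre sets between Cantor space and ℝ. -/

open PiNat in
theorem exists_cylinder_subset {U : Set (ℕ → Fin 2)} (hU : IsOpen U) {x : ℕ → Fin 2}
    (hx : x ∈ U) : ∃ n, cylinder x n ⊆ U := by
  obtain ⟨v, ⟨y, n, rfl⟩, hxv, hvU⟩ :=
    (isTopologicalBasis_cylinders (fun _ : ℕ ↦ Fin 2)).exists_subset_of_mem_open hx hU
  exact ⟨n, by rwa [mem_cylinder_iff_eq.1 hxv]⟩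

open PiNat in
theorem isOpen_of_cylinder_subset {U : Set (ℕ → Fin 2)}
    (h : ∀ x ∈ U, ∃ n, cylinder x n ⊆ U) : IsOpen U := by
  refine isOpen_iff_forall_mem_open.2 fun x hx ↦ ?_
  obtain ⟨n, hn⟩ := h x hx
  exact ⟨_, hn, isOpen_cylinder _ x n, self_mem_cylinder x n⟩

open PiNat in
theorem dense_of_cylinder_inter {U : Set (ℕ → Fin 2)}
    (h : ∀ x n, ∃ y ∈ cylinder x n, y ∈ U) : Dense U := by
  refine dense_iff_inter_open.2 fun V hV ⟨x, hx⟩ ↦ ?_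
  obtain ⟨n, hn⟩ := exists_cylinder_subset hV hx
  obtain ⟨y, hy, hyU⟩ := h x n
  exact ⟨y, hn hy, hyU⟩

open PiNat in
theorem exists_ofDigits_cylinder_superset_Ioo (a : ℕ → Fin 2) (n : ℕ) :
    ∃ p q : ℝ, p < q ∧ Set.Ioo p q ⊆ Real.ofDigits '' cylinder a n := by
  set p := ∑ i ∈ Finset.range n, Real.ofDigitsTerm a i with hp
  refine ⟨p, p + ((2 : ℝ) ^ n)⁻¹, by simp, ?_⟩
  rintro x ⟨hx1, hx2⟩
  have h2 : (0 : ℝ) < 2 ^ n := by positivity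
  obtain ⟨c, -, hc⟩ := Real.ofDigits_SurjOn (b := 2) (by norm_num)
    (show (2 : ℝ) ^ n * (x - p) ∈ Set.Icc (0 : ℝ) 1 by
      refine ⟨by have : 0 < x - p := by linarith
                 positivity, ?_⟩
      calc (2 : ℝ) ^ n * (x - p) ≤ 2 ^ n * (2 ^ n)⁻¹ := by gcongr; linarith
        _ = 1 := mul_inv_cancel₀ h2.ne')
  refine ⟨fun i ↦ if i < n then a i else c (i - n), fun i hi ↦ by simp [hi], ?_⟩
  rw [Real.ofDigits_eq_sum_add_ofDigits _ n]
  simp only [Nat.add_sub_cancel, show ∀ i, ¬ i + n < n by intro i; omega, if_false]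
  rw [hc, Finset.sum_congr rfl (g := Real.ofDigitsTerm a)]
  · rw [← hp]
    push_cast
    rw [inv_mul_cancel_left₀ h2.ne']
    ring
  · intro i hi
    simp [Real.ofDigitsTerm, Finset.mem_range.1 hi]

open PiNat in
theorem IsNowhereDense.image_ofDigits {N : Set (ℕ → Fin 2)} (hN : IsNowhereDense N) :
    IsNowhereDense (Real.ofDigits '' N) := by
  have hcl : IsClosed (Real.ofDigits '' closure N) :=
    (isClosed_closure.isCompact.image Real.continuous_ofDigits).isClosed
  refine IsNowhereDense.mono (Set.image_mono subset_closure) ?_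
  rw [hcl.isNowhereDense_iff, Set.eq_empty_iff_forall_notMem]
  intro x hx
  obtain ⟨b, hb, rfl⟩ := interior_subset hx
  set V : Set (ℕ → Fin 2) := Real.ofDigits ⁻¹' interior (Real.ofDigits '' closure N)
  have hV : IsOpen V := isOpen_interior.preimage Real.continuous_ofDigits
  obtain ⟨c, hcV, hcN⟩ : ∃ c ∈ V, c ∉ closure N := by
    by_contra! hcon
    have : b ∈ interior (closure N) := interior_maximal hcon hV hx
    rw [hN] at this
    exact this
  obtain ⟨n, hn⟩ := exists_cylinder_subset (hV.inter isClosed_closure.isOpen_compl) ⟨hcV, hcN⟩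
  -- An alternating tail makes the expansion unique, so the only possible preimage in `closure N` is
  -- `d` itself.
  set d : ℕ → Fin 2 := fun i ↦ if i < n then c i else if i % 2 = 0 then 0 else 1 with hd
  have hdc : d ∈ cylinder c n := fun i hi ↦ by simp [hd, hi]
  obtain ⟨d', hd'N, hdd'⟩ := interior_subset (hn hdc).1
  have : d = d' := by
    refine funext (eq_of_ofDigits_eq (fun m ↦ ⟨2 * (m + n), by omega, ?_⟩)
      (fun m ↦ ⟨2 * (m + n) + 1, by omega, ?_⟩) hdd'.symm)
    · simp [hd, show ¬ 2 * (m + n) < n by omega]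
    · simp [hd, show ¬ 2 * (m + n) + 1 < n by omega, Nat.add_mod]
  exact (hn hdc).2 (this ▸ hd'N)

theorem IsNowhereDense.preimage_ofDigits {N : Set ℝ} (hN : IsNowhereDense N) :
    IsNowhereDense (Real.ofDigits (b := 2) ⁻¹' N) := by
  have hcl : IsClosed (Real.ofDigits (b := 2) ⁻¹' closure N) :=
    isClosed_closure.preimage Real.continuous_ofDigits
  refine IsNowhereDense.mono (Set.preimage_mono subset_closure) ?_
  rw [hcl.isNowhereDense_iff, Set.eq_empty_iff_forall_notMem]
  intro x hx
  obtain ⟨n, hn⟩ := exists_cylinder_subset isOpen_interior hx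
  obtain ⟨p, q, hpq, hsub⟩ := exists_ofDigits_cylinder_superset_Ioo x n
  have h1 : Set.Ioo p q ⊆ closure N :=
    hsub.trans (Set.image_subset_iff.2 (hn.trans interior_subset))
  have h2 := interior_maximal h1 isOpen_Ioo
  rw [hN, Set.subset_empty_iff, Set.Ioo_eq_empty_iff] at h2
  exact h2 hpq

theorem IsMeagre.image_ofDigits {M : Set (ℕ → Fin 2)} (hM : IsMeagre M) :
    IsMeagre (Real.ofDigits '' M) := by
  obtain ⟨S, hS, hSc, hMS⟩ := isMeagre_iff_countable_union_isNowhereDense.1 hM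
  refine isMeagre_iff_countable_union_isNowhereDense.2
    ⟨(Real.ofDigits '' ·) '' S, ?_, hSc.image _, ?_⟩
  · rintro _ ⟨t, ht, rfl⟩
    exact (hS t ht).image_ofDigits
  · rintro _ ⟨x, hx, rfl⟩
    obtain ⟨t, ht, hxt⟩ := hMS hx
    exact ⟨_, ⟨t, ht, rfl⟩, x, hxt, rfl⟩

theorem IsMeagre.preimage_ofDigits {M : Set ℝ} (hM : IsMeagre M) :
    IsMeagre (Real.ofDigits (b := 2) ⁻¹' M) := by
  obtain ⟨S, hS, hSc, hMS⟩ := isMeagre_iff_countable_union_isNowhereDense.1 hM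
  refine isMeagre_iff_countable_union_isNowhereDense.2
    ⟨(Real.ofDigits ⁻¹' ·) '' S, ?_, hSc.image _, ?_⟩
  · rintro _ ⟨t, ht, rfl⟩
    exact (hS t ht).preimage_ofDigits
  · intro x hx
    obtain ⟨t, ht, hxt⟩ := hMS hx
    exact ⟨_, ⟨t, ht, rfl⟩, hxt⟩

/-- A family of meagre sets in a space which is cofinal among the meagre sets. -/
structure IsMeagreBase {X ι : Type*} [TopologicalSpace X] (M : ι → Set X) : Prop where
  isMeagre (i : ι) : IsMeagre (M i)
  cofinal {S : Set X} (hS : IsMeagre S) : ∃ i, S ⊆ M i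

theorem exists_isMeagreBase {ι : Type} (h : cofMeagre = #ι) :
    ∃ M : ι → Set (ℕ → Fin 2), IsMeagreBase M := by
  obtain ⟨s, hs, hsc⟩ := Order.exists_cof_eq {A : Set ℝ // IsMeagre A}
  obtain ⟨e⟩ := Cardinal.eq.1 ((hsc.trans h).symm)
  refine ⟨fun i ↦ Real.ofDigits ⁻¹' (e i).1.1, fun i ↦ (e i).1.2.preimage_ofDigits, ?_⟩
  intro S hS
  obtain ⟨b, hb, hSb⟩ := hs ⟨_, hS.image_ofDigits⟩
  refine ⟨e.symm ⟨b, hb⟩, ?_⟩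
  rw [e.apply_symm_apply]
  exact Set.image_subset_iff.1 hSb

/-! ### A dominating family from a base of the meagre ideal. -/

/-- The closed set of binary sequences with a `1` in each window `[n, f n)`. -/
def windowSet (f : ℕ → ℕ) : Set (ℕ → Fin 2) := {x | ∀ n, ∃ i, n ≤ i ∧ i < f n ∧ x i = 1}

open PiNat in
theorem isClosed_windowSet (f : ℕ → ℕ) : IsClosed (windowSet f) := by
  refine isOpen_compl_iff.1 (isOpen_of_cylinder_subset fun x hx ↦ ?_)
  simp only [windowSet, Set.mem_compl_iff, Set.mem_ofPred_eq, not_forall, not_exists] at hx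
  obtain ⟨n, hn⟩ := hx
  refine ⟨f n, fun y hy hyf ↦ ?_⟩
  obtain ⟨i, hi, hif, hyi⟩ := hyf n
  exact hn i ⟨hi, hif, by rw [← hy i hif, hyi]⟩

open PiNat in
theorem isNowhereDense_windowSet (f : ℕ → ℕ) : IsNowhereDense (windowSet f) := by
  refine ((isClosed_isNowhereDense_iff_compl).2
    ⟨(isClosed_windowSet f).isOpen_compl, dense_of_cylinder_inter fun x n ↦ ?_⟩).2
  refine ⟨fun i ↦ if i < n then x i else 0, fun i hi ↦ by simp [hi], fun h ↦ ?_⟩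
  obtain ⟨i, hi, -, h1⟩ := h n
  simp [not_lt.2 hi] at h1

-- `L` can be uniform in `a` because only the first `k` bits matter, leaving finitely many cases.
open PiNat in
theorem exists_avoiding_extension {N : Set (ℕ → Fin 2)} (hN : IsNowhereDense N) (k : ℕ) :
    ∃ L ≥ k, ∀ a : ℕ → Fin 2, ∃ b ∈ cylinder a k, Disjoint (cylinder b L) N := by
  have key : ∀ a : ℕ → Fin 2, ∃ L, ∃ b ∈ cylinder a k, Disjoint (cylinder b L) N := by
    intro a
    obtain ⟨b, hba, hbN⟩ : ∃ b ∈ cylinder a k, b ∉ closure N := by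
      by_contra! hcon
      have : a ∈ interior (closure N) :=
        interior_maximal hcon (isOpen_cylinder _ a k) (self_mem_cylinder a k)
      rw [hN] at this
      exact this
    obtain ⟨L, hL⟩ := exists_cylinder_subset isClosed_closure.isOpen_compl hbN
    exact ⟨L, b, hba, Set.disjoint_left.2 fun x hx hxN ↦ hL hx (subset_closure hxN)⟩
  choose L b hb hd using key
  let ext (t : Fin k → Fin 2) : ℕ → Fin 2 := fun i ↦ if h : i < k then t ⟨i, h⟩ else 0
  refine ⟨max k (Finset.univ.sup fun t ↦ L (ext t)), le_max_left _ _, fun a ↦ ?_⟩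
  set t : Fin k → Fin 2 := fun i ↦ a i
  have ht : ext t ∈ cylinder a k := fun i hi ↦ by simp [ext, hi, t]
  refine ⟨b (ext t), ?_, (hd (ext t)).mono_left (cylinder_anti _ ?_)⟩
  · rw [← mem_cylinder_iff_eq.1 ht]
    exact hb _
  · exact (Finset.le_sup (f := fun t ↦ L (ext t)) (Finset.mem_univ t)).trans (le_max_right _ _)

open PiNat in
theorem le_of_windowSet_inter_subset {N : Set (ℕ → Fin 2)} {g : ℕ → ℕ}
    (hg : ∀ k, k ≤ g k) (hgN : ∀ k, ∀ a : ℕ → Fin 2, ∃ b ∈ cylinder a k,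
      Disjoint (cylinder b (g k)) N)
    {f : ℕ → ℕ} (hf : Monotone f) (hf' : ∀ n, n < f n) {w : ℕ → Fin 2} (hw : w ∈ windowSet f)
    {m : ℕ} (hm : cylinder w m ∩ windowSet f ⊆ N) {k : ℕ} (hk : m < k) : f k ≤ g k := by
  by_contra! hlt
  obtain ⟨b, hb, hbN⟩ := hgN k (fun i ↦ if i < m then w i else 1)
  have hkL := hg k
  -- `z` follows `w` up to `m`, is 1 up to `k`, follows `b` up to `g k`, then is 1 again. If `g k <
  -- f k`, every window starting in `[k, g k)` reaches the 1 at `g k`, so `z` lies in `windowSet f`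
  -- although its cylinder avoids `N`.
  set z : ℕ → Fin 2 := fun i ↦ if i < g k then b i else 1 with hz
  have hzb : z ∈ cylinder b (g k) := fun i hi ↦ by simp [hz, hi]
  have z1 : ∀ i < m, z i = w i := fun i hi ↦ by
    rw [hzb i (by omega), hb i (by omega)]
    simp [hi]
  have z2 : ∀ i, m ≤ i → i < k → z i = 1 := fun i hi hik ↦ by
    rw [hzb i (by omega), hb i hik]
    simp [hi]
  have z3 : ∀ i, g k ≤ i → z i = 1 := fun i hi ↦ by simp [hz, hi]
  refine Set.disjoint_left.1 hbN hzb (hm ⟨z1, fun n ↦ ?_⟩)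
  have hn := hf' n
  rcases lt_or_ge n m with h1 | h1
  · obtain ⟨i, hi, hif, hwi⟩ := hw n
    rcases lt_or_ge i m with h2 | h2
    · exact ⟨i, hi, hif, by rw [z1 i h2, hwi]⟩
    · exact ⟨m, h1.le, by omega, z2 m le_rfl hk⟩
  rcases lt_or_ge n k with h2 | h2
  · exact ⟨n, le_rfl, hn, z2 n h1 h2⟩
  rcases lt_or_ge n (g k) with h3 | h3
  · exact ⟨g k, h3.le, hlt.trans_le (hf h2), z3 _ le_rfl⟩
  · exact ⟨n, le_rfl, hn, z3 _ h3⟩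

open PiNat in
/-- The dominating number is at most the cofinality of the meagre ideal. -/
theorem IsMeagreBase.exists_dominating {ι : Type*} {M : ι → Set (ℕ → Fin 2)}
    (hM : IsMeagreBase M) :
    ∃ d : ι × ℕ × ℕ → ℕ → ℕ, ∀ f : ℕ → ℕ, ∃ j, ∀ n, f n ≤ d j n := by
  have hN : ∀ i, ∃ N : ℕ → Set (ℕ → Fin 2), (∀ k, IsNowhereDense (N k)) ∧
      (∀ k, IsClosed (N k)) ∧ M i ⊆ ⋃ k, N k := by
    intro i
    obtain ⟨S, hS, hSc, hMS⟩ := isMeagre_iff_countable_union_isNowhereDense.1 (hM.isMeagre i)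
    rcases S.eq_empty_or_nonempty with rfl | hne
    · exact ⟨fun _ ↦ ∅, fun _ ↦ isNowhereDense_empty, fun _ ↦ isClosed_empty,
        hMS.trans (by simp)⟩
    obtain ⟨e, rfl⟩ := hSc.exists_eq_range hne
    refine ⟨fun k ↦ closure (e k), fun k ↦ (hS _ ⟨k, rfl⟩).closure, fun k ↦ isClosed_closure,
      fun x hx ↦ ?_⟩
    obtain ⟨_, ⟨k, rfl⟩, hk⟩ := hMS hx
    exact Set.mem_iUnion.2 ⟨k, subset_closure hk⟩
  choose N hNn hNc hMN using hN
  choose g hg hgN using fun i j k ↦ exists_avoiding_extension (hNn i j) k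
  refine ⟨fun j n ↦ g j.1 j.2.1 (n + j.2.2 + 1), fun f ↦ ?_⟩
  set F : ℕ → ℕ := fun n ↦ ∑ i ∈ Finset.range (n + 1), (f i + 1) with hF
  have hFm : Monotone F := monotone_nat_of_le_succ fun n ↦ by
    simp only [hF, Finset.sum_range_succ _ (n + 1)]
    omega
  have hFl : ∀ n, n < F n := fun n ↦ by
    simp only [hF, Finset.sum_add_distrib]
    simp
    omega
  have hfF : ∀ n, f n ≤ F n := fun n ↦ by
    simp only [hF, Finset.sum_range_succ]
    omega
  obtain ⟨i, hi⟩ := hM.cofinal (isNowhereDense_windowSet F).isMeagre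
  have : CompactSpace (windowSet F) :=
    isCompact_iff_compactSpace.1 (isClosed_windowSet F).isCompact
  have : Nonempty (windowSet F) := ⟨fun _ ↦ 1, fun n ↦ ⟨n, le_rfl, hFl n, rfl⟩⟩
  -- Baire category in the compact `windowSet F`: one closed `N i j` contains a relatively open
  -- piece. The stem length `m` of that piece becomes the shift in the index.
  obtain ⟨j, ⟨w, hw⟩, hwj⟩ := nonempty_interior_of_iUnion_of_closed
    (f := fun j ↦ ((↑) : windowSet F → ℕ → Fin 2) ⁻¹' N i j)
    (fun j ↦ (hNc i j).preimage continuous_subtype_val)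
    (by rw [← Set.preimage_iUnion, Set.eq_univ_iff_forall]; exact fun x ↦ hMN i (hi x.2))
  obtain ⟨U, hU, hUeq⟩ := isOpen_induced_iff.1
    (isOpen_interior (s := ((↑) : windowSet F → ℕ → Fin 2) ⁻¹' N i j))
  have hwU : w ∈ U := by
    rw [← hUeq] at hwj
    exact hwj
  obtain ⟨m, hm⟩ := exists_cylinder_subset hU hwU
  have hmN : cylinder w m ∩ windowSet F ⊆ N i j := by
    rintro x ⟨hx, hxF⟩
    have : (⟨x, hxF⟩ : windowSet F) ∈ interior (((↑) : windowSet F → ℕ → Fin 2) ⁻¹' N i j) := by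
      rw [← hUeq]
      exact hm hx
    exact (interior_subset this :
      (⟨x, hxF⟩ : windowSet F) ∈ ((↑) : windowSet F → ℕ → Fin 2) ⁻¹' N i j)
  refine ⟨(i, j, m), fun n ↦ (hfF n).trans ((hFm (by omega)).trans
    (le_of_windowSet_inter_subset (hg i j) (hgN i j) hFm hFl hw hmN
      (k := n + m + 1) (by omega)))⟩

/-! ### Generic descending walks and guessing of dense sets. -/

section Walk
variable {B : Type*} [Preorder B] (p : ℕ → B)

open Classical in
/-- The descending walk from `b` which at time `n` moves to `p n` if this is a descent and
the `n`-th bit of `x` is `1`. -/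
noncomputable def bitWalk (x : ℕ → Fin 2) (b : B) : ℕ → B
  | 0 => b
  | n + 1 => if x n = 1 ∧ p n ≤ bitWalk x b n then p n else bitWalk x b n

theorem bitWalk_succ_le (x : ℕ → Fin 2) (b : B) (n : ℕ) :
    bitWalk p x b (n + 1) ≤ bitWalk p x b n := by
  rw [bitWalk]
  split_ifs with h
  · exact h.2
  · exact le_rfl

theorem antitone_bitWalk (x : ℕ → Fin 2) (b : B) : Antitone (bitWalk p x b) :=
  antitone_nat_of_succ_le (bitWalk_succ_le p x b)

theorem bitWalk_congr {x y : ℕ → Fin 2} {n : ℕ} (h : y ∈ PiNat.cylinder x n) (b : B) :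
    bitWalk p y b n = bitWalk p x b n := by
  induction n with
  | zero => rfl
  | succ n ih =>
    rw [bitWalk, bitWalk, ih (PiNat.cylinder_anti x n.le_succ h), h n n.lt_succ_self]

-- After any finite stem, append zeros to keep the walk still until `p` lists a point of `G` below
-- the current position, then a single 1 to move there.
open PiNat in
theorem bitWalk_mem_residual (hp : ∀ b n, ∃ m ≥ n, p m = b) {G : Set B} (hG : ∀ b, ∃ c ≤ b, c ∈ G)
    (b : B) : {x | ∃ m, bitWalk p x b m ∈ G} ∈ residual (ℕ → Fin 2) := by
  refine residual_of_dense_open (isOpen_of_cylinder_subset ?_) (dense_of_cylinder_inter ?_)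
  · rintro x ⟨m, hm⟩
    exact ⟨m, fun y hy ↦ ⟨m, by rwa [bitWalk_congr p hy]⟩⟩
  · intro x n
    obtain ⟨c, hc, hcG⟩ := hG (bitWalk p x b n)
    obtain ⟨m, hm, rfl⟩ := hp c n
    set y : ℕ → Fin 2 := fun i ↦ if i < n then x i else if i = m then 1 else 0 with hy
    have hyx : y ∈ cylinder x n := fun i hi ↦ by simp [hy, hi]
    refine ⟨y, hyx, m + 1, ?_⟩
    have h1 : ∀ k, n ≤ k → k ≤ m → bitWalk p y b k = bitWalk p x b n := by
      intro k hk
      induction k, hk using Nat.le_induction with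
      | base => exact fun _ ↦ bitWalk_congr p hyx b
      | succ k hk ih =>
        intro hkm
        have : y k = 0 := by simp [hy, not_lt.2 hk, show k ≠ m by omega]
        rw [bitWalk, this, ih (by omega)]
        simp
    rw [bitWalk, h1 m hm le_rfl, if_pos ⟨by simp [hy, not_lt.2 hm], hc⟩]
    exact hcG

end Walk

/-- Given a base of the meagre ideal indexed by `ι`, sequences of dense lower subsets of a countable
preorder can be uniformly guessed by a family indexed by `ι × ι × ℕ × ℕ`. -/
theorem IsMeagreBase.exists_guessing {ι : Type*} {M : ι → Set (ℕ → Fin 2)}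
    (hM : IsMeagreBase M) (B : Type*) [Preorder B] [Countable B] :
    ∃ H : ι × ι × ℕ × ℕ → ℕ → B → B, (∀ j n b, H j n b ≤ b) ∧
      ∀ G : ℕ → Set B, (∀ n, IsLowerSet (G n)) → (∀ n b, ∃ c ≤ b, c ∈ G n) →
        ∃ j, ∀ n b, H j n b ∈ G n := by
  cases isEmpty_or_nonempty B
  · obtain ⟨i, -⟩ := hM.cofinal IsMeagre.empty
    exact ⟨fun _ _ b ↦ b, fun _ _ _ ↦ le_rfl, fun _ _ _ ↦ ⟨(i, i, 0, 0), fun _ b ↦ isEmptyElim b⟩⟩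
  obtain ⟨e, he⟩ := exists_surjective_nat B
  set p : ℕ → B := fun n ↦ e n.unpair.1
  have hp : ∀ b n, ∃ m ≥ n, p m = b := fun b n ↦ by
    obtain ⟨k, rfl⟩ := he b
    exact ⟨Nat.pair k n, Nat.right_le_pair k n, by simp [p]⟩
  obtain ⟨d, hd⟩ := hM.exists_dominating
  have hy : ∀ i, ∃ y, y ∉ M i := fun i ↦ by
    by_contra! hcon
    refine not_isMeagre_of_isOpen (X := ℕ → Fin 2) isOpen_univ Set.univ_nonempty
      ((hM.isMeagre i).mono ?_)
    exact fun x _ ↦ hcon x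
  choose y hy using hy
  obtain ⟨c, hc⟩ := exists_injective_nat (ℕ × B)
  -- `y j.1` supplies the generic bits and `d j.2` a bound on all waiting times at once, coded
  -- through `c`. Overshooting is harmless: the walk descends and the `G n` are lower sets.
  refine ⟨fun j n b ↦ bitWalk p (y j.1) b (d j.2 (c (n, b))), fun j n b ↦
    antitone_bitWalk p _ b (Nat.zero_le _), fun G hGl hG ↦ ?_⟩
  have hres : (⋂ q : ℕ × B, {x | ∃ m, bitWalk p x q.2 m ∈ G q.1}) ∈ residual (ℕ → Fin 2) :=
    countable_iInter_mem.2 fun q ↦ bitWalk_mem_residual p hp (hG q.1) q.2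
  obtain ⟨i, hi⟩ := hM.cofinal (S := (⋂ q : ℕ × B, {x | ∃ m, bitWalk p x q.2 m ∈ G q.1})ᶜ)
    (by rwa [IsMeagre, compl_compl])
  have hyi : ∀ q : ℕ × B, ∃ m, bitWalk p (y i) q.2 m ∈ G q.1 := by
    have := not_imp_comm.1 (@hi (y i)) (hy i)
    simpa using this
  choose m hm using hyi
  obtain ⟨j, hj⟩ := hd (fun k ↦ m (Function.invFun c k))
  refine ⟨(i, j), fun n b ↦ hGl n (antitone_bitWalk p _ b (hj (c (n, b)))) ?_⟩
  rw [Function.leftInverse_invFun hc]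
  exact hm (n, b)

/-! ### Splitting countably many infinite sets. -/

theorem exists_injective_mem_of_infinite {P : Type*} {T : ℕ → Set P} (hT : ∀ m, (T m).Infinite) :
    ∃ h : ℕ → P, Function.Injective h ∧ ∀ m, h m ∈ T m := by
  classical
  have key : ∀ (m : ℕ) (s : Finset P), ∃ x ∈ T m, x ∉ s := fun m s ↦
    (hT m).exists_notMem_finset s
  choose x hx hxs using key
  let h : ℕ → P := fun m ↦ Nat.strongRec (motive := fun _ ↦ P)
    (fun m ih ↦ x m (Finset.univ.image fun i : Fin m ↦ ih i i.2)) m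
  have hh : ∀ m, h m = x m (Finset.univ.image fun i : Fin m ↦ h i) := fun m ↦ by
    simp only [h]
    rw [Nat.strongRec_eq]
  refine ⟨h, fun i j heq ↦ by_contra fun hne ↦ ?_, fun m ↦ by rw [hh]; exact hx _ _⟩
  have hlt : ∀ i j, i < j → h i ≠ h j := fun i j hij heq ↦ by
    have := hxs j (Finset.univ.image fun i : Fin j ↦ h i)
    rw [← hh] at this
    exact this (Finset.mem_image.2 ⟨⟨i, hij⟩, Finset.mem_univ _, heq⟩)
  rcases Nat.lt_or_gt_of_ne hne with hij | hij
  · exact hlt i j hij heq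
  · exact hlt j i hij heq.symm

/-- Countably many infinite sets can be simultaneously split. -/
theorem exists_splitting {P K : Type*} [Countable K] {T : K → Set P}
    (hT : ∀ m, (T m).Infinite) :
    ∃ S : Set P, ∀ m, (T m ∩ S).Infinite ∧ (T m \ S).Infinite := by
  cases isEmpty_or_nonempty K
  · exact ⟨∅, fun m ↦ isEmptyElim m⟩
  obtain ⟨e, he⟩ := exists_surjective_nat K
  obtain ⟨h, hi, hm⟩ := exists_injective_mem_of_infinite (fun m ↦ hT (e m.unpair.1))
  -- Each set is visited infinitely often, and the parity of the visit decides the side.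
  refine ⟨{x | ∃ m, m.unpair.2 % 2 = 0 ∧ h m = x}, fun k ↦ ?_⟩
  obtain ⟨k, rfl⟩ := he k
  constructor
  · refine Set.infinite_of_injective_forall_mem (f := fun i : ℕ ↦ h (Nat.pair k (2 * i)))
      (fun i j hij ↦ ?_) fun i ↦ ⟨?_, Nat.pair k (2 * i), by simp, rfl⟩
    · have := (Nat.pair_eq_pair.1 (hi hij)).2
      omega
    · simpa using hm (Nat.pair k (2 * i))
  · refine Set.infinite_of_injective_forall_mem (f := fun i : ℕ ↦ h (Nat.pair k (2 * i + 1)))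
      (fun i j hij ↦ ?_) fun i ↦ ⟨?_, ?_⟩
    · have := (Nat.pair_eq_pair.1 (hi hij)).2
      omega
    · simpa using hm (Nat.pair k (2 * i + 1))
    · rintro ⟨m, hm0, hmeq⟩
      rw [hi hmeq] at hm0
      simp at hm0

/-! ### Finite conditions and the recursive construction of the independent family. -/

section Conditions
variable {W P : Type*}

/-- A finite set of sign requirements, none of which contradict each other. -/
def Consistent (u : Finset (W × Bool)) : Prop := ∀ α, ¬ ((α, true) ∈ u ∧ (α, false) ∈ u)

/-- The boolean combination of the sets `A α` prescribed by `u`. -/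
def boolCyl (A : W → Set P) (u : Finset (W × Bool)) : Set P :=
  {x | ∀ q ∈ u, x ∈ A q.1 ↔ q.2 = true}

theorem Consistent.mono {u v : Finset (W × Bool)} (hv : Consistent v) (h : u ⊆ v) :
    Consistent u := fun α hα ↦ hv α ⟨h hα.1, h hα.2⟩

theorem boolCyl_anti (A : W → Set P) {u v : Finset (W × Bool)} (h : u ⊆ v) :
    boolCyl A v ⊆ boolCyl A u := fun _ hx q hq ↦ hx q (h hq)

variable [LinearOrder W]

/-- Finite consistent requirements on the coordinates below `β`. -/
def CondBelow (β : W) : Type _ :=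
  {u : Finset (W × Bool) // Consistent u ∧ ∀ q ∈ u, q.1 < β}

instance (β : W) : Preorder (CondBelow β) where
  le u v := v.1 ⊆ u.1
  le_refl u := Finset.Subset.refl u.1
  le_trans _ _ _ h h' := Finset.Subset.trans h' h

theorem countable_condBelow {β : W} (h : (Set.Iio β).Countable) : Countable (CondBelow β) := by
  have hc : (Set.Iio β ×ˢ (Set.univ : Set Bool)).Countable := h.prod Set.countable_univ
  have : {u : Finset (W × Bool) | (u : Set (W × Bool)) ⊆ Set.Iio β ×ˢ Set.univ}.Countable := by
    have h1 := Set.countable_ofPred_finite_subset hc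
    have h2 := h1.preimage_of_injOn (f := fun u : Finset (W × Bool) ↦ (u : Set (W × Bool)))
      Finset.coe_injective.injOn
    refine h2.mono fun u hu ↦ ?_
    exact Set.mem_preimage.2 (Set.mem_ofPred_eq ▸ And.intro u.finite_toSet hu)
  have hsub : {u : Finset (W × Bool) | Consistent u ∧ ∀ q ∈ u, q.1 < β} ⊆
      {u | (u : Set (W × Bool)) ⊆ Set.Iio β ×ˢ Set.univ} :=
    fun u hu q hq ↦ Set.mk_mem_prod (hu.2 q hq) (Set.mem_univ q.2)
  exact (this.mono hsub).to_subtype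

/-- `E` is nowhere dense for the topology generated by the `A α`, `α < β`, and their complements. -/
def NwdBelow (A : W → Set P) (β : W) (E : Set P) : Prop :=
  ∀ u : CondBelow β, ∃ v ≤ u, Disjoint (boolCyl A v.1) E

theorem boolCyl_congr {A A' : W → Set P} {β : W} (h : ∀ γ < β, A γ = A' γ)
    {u : Finset (W × Bool)} (hu : ∀ q ∈ u, q.1 < β) : boolCyl A u = boolCyl A' u := by
  ext x
  exact forall₂_congr fun q hq ↦ by rw [h _ (hu q hq)]

theorem NwdBelow.congr {A A' : W → Set P} {β : W} (h : ∀ γ < β, A γ = A' γ) {E : Set P}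
    (hE : NwdBelow A β E) : NwdBelow A' β E := fun u ↦ by
  obtain ⟨v, hv, hd⟩ := hE u
  exact ⟨v, hv, by rwa [← boolCyl_congr h v.2.2]⟩

theorem NwdBelow.mono_right {A : W → Set P} {α β : W} (h : α ≤ β) {E : Set P}
    (hE : NwdBelow A α E) : NwdBelow A β E := fun u ↦ by
  classical
  obtain ⟨v, hv, hd⟩ := hE ⟨u.1.filter fun q ↦ q.1 < α, u.2.1.mono (Finset.filter_subset _ _),
    fun q hq ↦ (Finset.mem_filter.1 hq).2⟩
  -- `v` mentions only coordinates below `α`, where it already extends `u`; hence the union stays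
  -- consistent.
  have hmix : ∀ γ s, (γ, s) ∈ u.1 → ∀ t, (γ, t) ∈ v.1 → (γ, s) ∈ v.1 := fun γ s hs t ht ↦
    hv (Finset.mem_filter.2 ⟨hs, show γ < α from v.2.2 (γ, t) ht⟩)
  refine ⟨⟨v.1 ∪ u.1, ?_, ?_⟩, Finset.subset_union_right,
    hd.mono_left (boolCyl_anti A Finset.subset_union_left)⟩
  · rintro γ ⟨h1, h2⟩
    rcases Finset.mem_union.1 h1 with h1 | h1 <;> rcases Finset.mem_union.1 h2 with h2 | h2
    · exact v.2.1 γ ⟨h1, h2⟩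
    · exact v.2.1 γ ⟨h1, hmix _ _ h2 _ h1⟩
    · exact v.2.1 γ ⟨hmix _ _ h1 _ h2, h2⟩
    · exact u.2.1 γ ⟨h1, h2⟩
  · intro q hq
    rcases Finset.mem_union.1 hq with hq | hq
    · exact (v.2.2 q hq).trans_le h
    · exact u.2.2 q hq

/-- The conditions whose combination avoids `E n` form a dense lower set. A guess that selects from
all of them bounds `E n` by the complement of the selected combinations. -/
theorem exists_cofinal_nwdBelow {M : W → Set (ℕ → Fin 2)} (hM : IsMeagreBase M)
    (A : W → Set P) {β : W} (hβ : (Set.Iio β).Countable) :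
    ∃ F : W × W × ℕ × ℕ → ℕ → Set P, (∀ j n, NwdBelow A β (F j n)) ∧
      ∀ E : ℕ → Set P, (∀ n, NwdBelow A β (E n)) → ∃ j, ∀ n, E n ⊆ F j n := by
  have := countable_condBelow hβ
  obtain ⟨H, hH, hG⟩ := hM.exists_guessing (CondBelow β)
  refine ⟨fun j n ↦ (⋃ u, boolCyl A (H j n u).1)ᶜ, fun j n u ↦ ⟨_, hH j n u, ?_⟩, fun E hE ↦ ?_⟩
  · exact Set.disjoint_compl_right_iff_subset.2
      (Set.subset_iUnion (fun u ↦ boolCyl A (H j n u).1) u)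
  · obtain ⟨j, hj⟩ := hG (fun n ↦ {u | Disjoint (boolCyl A u.1) (E n)})
      (fun n u v hvu hu ↦ Disjoint.mono_left (boolCyl_anti A hvu) hu) hE
    refine ⟨j, fun n x hx hxU ↦ ?_⟩
    obtain ⟨u, hu⟩ := Set.mem_iUnion.1 hxU
    exact Set.disjoint_left.1 (hj n u) hu hx

/-- Every boolean combination of the sets `A α` with `α < β` meets each column in an
infinite set. -/
def IndepBelow (A : W → Set (ℕ × ℕ)) (β : W) : Prop :=
  ∀ u : CondBelow β, ∀ n, {k | (n, k) ∈ boolCyl A u.1}.Infinite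

theorem IndepBelow.congr {A A' : W → Set (ℕ × ℕ)} {β : W} (h : ∀ γ < β, A γ = A' γ)
    (hA : IndepBelow A β) : IndepBelow A' β := fun u n ↦ by
  rw [← boolCyl_congr h u.2.2]
  exact hA u n

/-- `S` splits every boolean combination of the sets `A α` with `α < β` in each column and misses
`F n` in the `n`-th column. -/
def IsGoodStep (A : W → Set (ℕ × ℕ)) (β : W) (F : ℕ → Set (ℕ × ℕ)) (S : Set (ℕ × ℕ)) : Prop :=
  (∀ u : CondBelow β, ∀ n, {k | (n, k) ∈ boolCyl A u.1 ∧ (n, k) ∈ S}.Infinite ∧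
    {k | (n, k) ∈ boolCyl A u.1 ∧ (n, k) ∉ S}.Infinite) ∧
  ∀ n k, (n, k) ∈ S → (n, k) ∉ F n

theorem IsGoodStep.congr {A A' : W → Set (ℕ × ℕ)} {β : W} (h : ∀ γ < β, A γ = A' γ)
    {F : ℕ → Set (ℕ × ℕ)} {S : Set (ℕ × ℕ)} (hS : IsGoodStep A β F S) :
    IsGoodStep A' β F S :=
  ⟨fun u n ↦ by rw [← boolCyl_congr h u.2.2]; exact hS.1 u n, hS.2⟩

/-- Remove `F n` from column `n` of a splitting set. The inside half stays infinite, since each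
condition has a stronger one avoiding `F n` that is also split; the outside half only grows. -/
theorem exists_isGoodStep {A : W → Set (ℕ × ℕ)} {β : W} (hβ : (Set.Iio β).Countable)
    (hA : IndepBelow A β) {F : ℕ → Set (ℕ × ℕ)} (hF : ∀ n, NwdBelow A β (F n)) :
    ∃ S, IsGoodStep A β F S := by
  have := countable_condBelow hβ
  obtain ⟨S, hS⟩ := exists_splitting
    (T := fun q : CondBelow β × ℕ ↦ (Prod.mk q.2) '' {k | (q.2, k) ∈ boolCyl A q.1.1})
    (fun q ↦ (hA q.1 q.2).image (Prod.mk_right_injective _).injOn)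
  refine ⟨{x | x ∈ S ∧ x ∉ F x.1}, fun u n ↦ ⟨?_, ?_⟩, fun n k h ↦ h.2⟩
  · obtain ⟨v, hvu, hv⟩ := hF n u
    refine ((hS (v, n)).1.preimage (f := Prod.mk n) ?_).mono ?_
    · rintro _ ⟨⟨k, -, rfl⟩, -⟩
      exact ⟨k, rfl⟩
    · rintro k ⟨⟨k', hk, hkk⟩, hkS⟩
      obtain rfl : k' = k := (Prod.mk.inj hkk).2
      exact ⟨boolCyl_anti A hvu hk, hkS, Set.disjoint_left.1 hv hk⟩
  · refine ((hS (u, n)).2.preimage (f := Prod.mk n) ?_).mono ?_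
    · rintro _ ⟨⟨k, -, rfl⟩, -⟩
      exact ⟨k, rfl⟩
    · rintro k ⟨⟨k', hk, hkk⟩, hkS⟩
      obtain rfl : k' = k := (Prod.mk.inj hkk).2
      exact ⟨hk, fun h ↦ hkS h.1⟩

theorem infinite_boolCyl_of_forall_le {A : W → Set (ℕ × ℕ)} {γ : W} {F : ℕ → Set (ℕ × ℕ)}
    (hA : IsGoodStep A γ F (A γ)) {u : Finset (W × Bool)} (hu : Consistent u)
    (huγ : ∀ q ∈ u, q.1 ≤ γ) (n : ℕ) : {k | (n, k) ∈ boolCyl A u}.Infinite := by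
  classical
  have hA' := hA.1 ⟨u.filter fun q ↦ q.1 < γ, hu.mono (Finset.filter_subset _ _),
    fun q hq ↦ (Finset.mem_filter.1 hq).2⟩ n
  by_cases h : (γ, false) ∈ u
  · refine hA'.2.mono fun k hk q hq ↦ ?_
    rcases (huγ q hq).lt_or_eq with h1 | h1
    · exact hk.1 q (Finset.mem_filter.2 ⟨hq, h1⟩)
    · obtain ⟨δ, s⟩ := q
      obtain rfl : δ = γ := h1
      cases s
      · simpa using hk.2
      · exact absurd ⟨hq, h⟩ (hu δ)
  · refine hA'.1.mono fun k hk q hq ↦ ?_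
    rcases (huγ q hq).lt_or_eq with h1 | h1
    · exact hk.1 q (Finset.mem_filter.2 ⟨hq, h1⟩)
    · obtain ⟨δ, s⟩ := q
      obtain rfl : δ = γ := h1
      cases s
      · exact absurd hq h
      · simpa using hk.2

/-- A finite condition has a largest coordinate, and the good step taken there reduces it to smaller
ones. -/
theorem infinite_boolCyl_of_isGoodStep [WellFoundedLT W] {A : W → Set (ℕ × ℕ)}
    {F : W → ℕ → Set (ℕ × ℕ)} (hA : ∀ γ, IndepBelow A γ → IsGoodStep A γ (F γ) (A γ))
    {u : Finset (W × Bool)} (hu : Consistent u) (n : ℕ) :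
    {k | (n, k) ∈ boolCyl A u}.Infinite := by
  have h0 : {k | (n, k) ∈ boolCyl A ∅}.Infinite := by
    simpa [boolCyl] using Set.infinite_univ
  have key : ∀ γ, IndepBelow A γ := by
    intro γ
    induction γ using WellFoundedLT.induction with
    | ind γ ih =>
      intro v m
      rcases v.1.eq_empty_or_nonempty with hv | hv
      · rw [hv]
        simpa [boolCyl] using Set.infinite_univ
      · obtain ⟨q, hq, hmax⟩ := v.1.exists_max_image Prod.fst hv
        exact infinite_boolCyl_of_forall_le (hA q.1 (ih q.1 (v.2.2 q hq))) v.2.1 hmax m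
  rcases u.eq_empty_or_nonempty with rfl | hne
  · exact h0
  · obtain ⟨q, hq, hmax⟩ := u.exists_max_image Prod.fst hne
    exact infinite_boolCyl_of_forall_le (hA q.1 (key q.1)) hu hmax n

open Classical in
/-- The family `A` with the coordinates from `β` on replaced by `∅`. -/
noncomputable def truncBelow (A : W → Set P) (β : W) : W → Set P :=
  fun γ ↦ if γ < β then A γ else ∅

theorem truncBelow_eq (A : W → Set P) {β γ : W} (h : γ < β) : truncBelow A β γ = A γ := if_pos h

theorem truncBelow_truncBelow (A : W → Set P) {α β : W} (h : α ≤ β) :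
    truncBelow (truncBelow A β) α = truncBelow A α := by
  funext γ
  unfold truncBelow
  split_ifs with h1 h2
  · rfl
  · exact absurd (h1.trans_le h) h2
  · rfl

theorem exists_forall_eq_truncBelow [WellFoundedLT W] (G : (W → Set P) → W → Set P) :
    ∃ A : W → Set P, ∀ β, A β = G (truncBelow A β) β := by
  classical
  refine ⟨WellFoundedLT.fix (motive := fun _ ↦ Set P) fun β ih ↦
    G (fun γ ↦ if h : γ < β then ih γ h else ∅) β, fun β ↦ ?_⟩
  rw [WellFoundedLT.fix_eq]
  congr 1

theorem exists_independent_family [WellFoundedLT W] (hW : ∀ β : W, (Set.Iio β).Countable)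
    {M : W → Set (ℕ → Fin 2)} (hM : IsMeagreBase M) {φ : W → W × (W × W × ℕ × ℕ)}
    (hφ : ∀ α j, ∃ β ≥ α, φ β = (α, j)) :
    ∃ A : W → Set (ℕ × ℕ),
      (∀ u, Consistent u → ∀ n, {k | (n, k) ∈ boolCyl A u}.Infinite) ∧
      ∀ α (E : ℕ → Set (ℕ × ℕ)), (∀ n, NwdBelow A α (E n)) →
        ∃ β, ∀ n k, (n, k) ∈ A β → (n, k) ∉ E n := by
  classical
  choose Fam hFam hcof using fun (A : W → Set (ℕ × ℕ)) (β : W) ↦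
    exists_cofinal_nwdBelow hM A (hW β)
  let F (A : W → Set (ℕ × ℕ)) (β : W) : ℕ → Set (ℕ × ℕ) :=
    -- Truncation makes the chosen family depend only on `A` below `(φ β).1`, so all later stages
    -- enumerate the same family.
    if (φ β).1 ≤ β then Fam (truncBelow A (φ β).1) (φ β).1 (φ β).2 else fun _ ↦ ∅
  have hF : ∀ A β n, NwdBelow A β (F A β n) := by
    intro A β n
    by_cases h : (φ β).1 ≤ β
    · simp only [F, if_pos h]
      exact ((hFam _ _ _ _).congr fun γ hγ ↦ truncBelow_eq A hγ).mono_right h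
    · simp only [F, if_neg h]
      exact fun u ↦ ⟨u, le_rfl, Set.disjoint_empty _⟩
  -- Independence is proved only after the recursion, so the step must be defined without it.
  have hex : ∀ A β, ∃ S, IndepBelow A β → IsGoodStep A β (F A β) S := by
    intro A β
    by_cases h : IndepBelow A β
    · obtain ⟨S, hS⟩ := exists_isGoodStep (hW β) h (hF A β)
      exact ⟨S, fun _ ↦ hS⟩
    · exact ⟨∅, fun h' ↦ absurd h' h⟩
  choose G hG using hex
  obtain ⟨A, hA⟩ := exists_forall_eq_truncBelow G
  have hFt : ∀ β, F (truncBelow A β) β = F A β := by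
    intro β
    by_cases h : (φ β).1 ≤ β
    · simp only [F, if_pos h, truncBelow_truncBelow A h]
    · simp only [F, if_neg h]
  have hgood : ∀ β, IndepBelow A β → IsGoodStep A β (F A β) (A β) := by
    intro β hβ
    have := hG (truncBelow A β) β (hβ.congr fun γ hγ ↦ (truncBelow_eq A hγ).symm)
    rw [← hA, hFt] at this
    exact this.congr fun γ hγ ↦ truncBelow_eq A hγ
  have hind : ∀ u, Consistent u → ∀ n, {k | (n, k) ∈ boolCyl A u}.Infinite :=
    fun u hu ↦ infinite_boolCyl_of_isGoodStep hgood hu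
  refine ⟨A, hind, fun α E hE ↦ ?_⟩
  obtain ⟨j, hj⟩ := hcof (truncBelow A α) α E fun n ↦
    (hE n).congr fun γ hγ ↦ (truncBelow_eq A hγ).symm
  obtain ⟨β, hβ, hφβ⟩ := hφ α j
  refine ⟨β, fun n k hk hkE ↦ (hgood β fun u ↦ hind u.1 u.2.1).2 n k hk ?_⟩
  have h1 : (φ β).1 ≤ β := by rw [hφβ]; exact hβ
  simp only [F, if_pos h1, hφβ]
  exact hj n hkE

end Conditions

/-- Every operation on finite sets of requirements has a closure point below which it stays. -/
theorem exists_closed_below {W : Type*} [LinearOrder W] [WellFoundedLT W] [Nonempty W]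
    (hW : ∀ β : W, (Set.Iio β).Countable) (hb : ∀ s : Set W, s.Countable → ∃ β, ∀ γ ∈ s, γ < β)
    (f : ℕ → Finset (W × Bool) → Finset (W × Bool)) :
    ∃ α, ∀ n u, Consistent u → (∀ q ∈ u, q.1 < α) → ∀ q ∈ f n u, q.1 < α := by
  have key : ∀ β : W, ∃ β', β < β' ∧ ∀ n, ∀ u : CondBelow β, ∀ q ∈ f n u.1, q.1 < β' := by
    intro β
    have := countable_condBelow (hW β)
    obtain ⟨β', h⟩ := hb ({β} ∪ ⋃ n, ⋃ u : CondBelow β, Prod.fst '' (f n u.1 : Set (W × Bool)))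
      ((Set.countable_singleton β).union (Set.countable_iUnion fun n ↦ Set.countable_iUnion
        fun u ↦ ((f n u.1).finite_toSet.image _).countable))
    refine ⟨β', h β (Or.inl rfl), fun n u q hq ↦ h _ (Or.inr ?_)⟩
    exact Set.mem_iUnion.2 ⟨n, Set.mem_iUnion.2 ⟨u, q, hq, rfl⟩⟩
  choose nx hlt hnx using key
  let a : ℕ → W := fun k ↦ nx^[k] (Classical.arbitrary W)
  have ha : ∀ k, a (k + 1) = nx (a k) := fun k ↦ Function.iterate_succ_apply' _ _ _
  have hmono : StrictMono a := strictMono_nat_of_lt_succ fun k ↦ by rw [ha]; exact hlt _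
  obtain ⟨β, hβ⟩ := hb (Set.range a) (Set.countable_range a)
  -- As `α` is the least strict upper bound of the `a k`, a finite condition below `α` is already
  -- below some `a k`.
  obtain ⟨α, hα, hmin⟩ := WellFounded.has_min (wellFounded_lt (α := W)) {β | ∀ k, a k < β}
    ⟨β, fun k ↦ hβ _ ⟨k, rfl⟩⟩
  have hsup : ∀ γ < α, ∃ k, γ ≤ a k := fun γ hγ ↦ by
    by_contra! hcon
    exact hmin γ hcon hγ
  refine ⟨α, fun n u hu huα q hq ↦ ?_⟩
  obtain ⟨k, hk⟩ : ∃ k, ∀ q ∈ u, q.1 < a k := by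
    rcases u.eq_empty_or_nonempty with rfl | hne
    · exact ⟨0, by simp⟩
    · obtain ⟨q, hq, hmax⟩ := u.exists_max_image Prod.fst hne
      obtain ⟨k, hk⟩ := hsup q.1 (huα q hq)
      exact ⟨k + 1, fun r hr ↦ ((hmax r hr).trans hk).trans_lt (hmono k.lt_succ_self)⟩
  refine (hnx (a k) n ⟨u, hu, hk⟩ q hq).trans ?_
  rw [← ha]
  exact hα _

/-! ### The countable dense subspace and its failure of NWD-separability. -/

section Points
variable {W : Type*}

theorem exists_finset_agree_subset {U : Set (W → Bool)} (hU : IsOpen U) {f : W → Bool}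
    (hf : f ∈ U) : ∃ I : Finset W, ∀ g : W → Bool, (∀ i ∈ I, g i = f i) → g ∈ U := by
  obtain ⟨I, v, hv, hsub⟩ := isOpen_pi_iff.1 hU f hf
  exact ⟨I, fun g hg ↦ hsub fun i hi ↦ by rw [hg i hi]; exact (hv i hi).2⟩

theorem isOpen_setOf_forall_mem_eq (u : Finset (W × Bool)) :
    IsOpen {g : W → Bool | ∀ q ∈ u, g q.1 = q.2} := by
  have : {g : W → Bool | ∀ q ∈ u, g q.1 = q.2} = ⋂ q ∈ u, (fun g ↦ g q.1) ⁻¹' {q.2} := by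
    ext g
    simp
  rw [this]
  exact isOpen_biInter_finset fun q _ ↦ (isOpen_discrete _).preimage (continuous_apply q.1)

open Classical in
/-- The point of the cube whose coordinates record membership of `p` in the sets `A α`. -/
noncomputable def cubePoint {P : Type*} (A : W → Set P) (p : P) : W → Bool :=
  fun α ↦ decide (p ∈ A α)

theorem cubePoint_eq_true {P : Type*} {A : W → Set P} {p : P} {α : W} :
    cubePoint A p α = true ↔ p ∈ A α := by simp [cubePoint]

theorem mem_boolCyl_iff {P : Type*} {A : W → Set P} {p : P} {u : Finset (W × Bool)} :
    p ∈ boolCyl A u ↔ ∀ q ∈ u, cubePoint A p q.1 = q.2 :=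
  forall₂_congr fun q _ ↦ by rw [← cubePoint_eq_true, Bool.eq_iff_iff (b := q.2)]

theorem consistent_of_forall_eq {u : Finset (W × Bool)} {g : W → Bool}
    (h : ∀ q ∈ u, g q.1 = q.2) : Consistent u := fun α hα ↦ by
  have h1 := h _ hα.1
  have h2 := h _ hα.2
  simp_all

theorem dense_cubePoint_column {A : W → Set (ℕ × ℕ)}
    (hA : ∀ u, Consistent u → ∀ n, {k | (n, k) ∈ boolCyl A u}.Infinite) (n : ℕ) :
    Dense (Set.range fun k ↦ cubePoint A (n, k)) := by
  classical
  refine dense_iff_inter_open.2 fun U hU ⟨f, hf⟩ ↦ ?_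
  obtain ⟨I, hI⟩ := exists_finset_agree_subset hU hf
  have hu : ∀ q ∈ I.image fun i ↦ (i, f i), f q.1 = q.2 := by
    intro q hq
    obtain ⟨i, -, rfl⟩ := Finset.mem_image.1 hq
    rfl
  obtain ⟨k, hk⟩ := (hA _ (consistent_of_forall_eq hu) n).nonempty
  exact ⟨_, hI _ fun i hi ↦ mem_boolCyl_iff.1 hk _ (Finset.mem_image_of_mem _ hi), k, rfl⟩

/-- Some point satisfying `u` lies outside the closure of `E`; finitely many of its coordinates,
added to `u`, describe a neighbourhood avoiding `E`. -/
theorem exists_disjoint_boolCyl {A : W → Set (ℕ × ℕ)}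
    (hA : ∀ u, Consistent u → ∀ n, {k | (n, k) ∈ boolCyl A u}.Infinite)
    {E : Set (Set.range (cubePoint A))} (hE : IsNowhereDense E) {u : Finset (W × Bool)}
    (hu : Consistent u) :
    ∃ v, Consistent v ∧ u ⊆ v ∧
      Disjoint (boolCyl A v) ((fun p ↦ (⟨_, p, rfl⟩ : Set.range (cubePoint A))) ⁻¹' E) := by
  classical
  set O : Set (Set.range (cubePoint A)) := {y | ∀ q ∈ u, y.1 q.1 = q.2}
  have hO : IsOpen O := (isOpen_setOf_forall_mem_eq u).preimage continuous_subtype_val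
  obtain ⟨k, hk⟩ := (hA u hu 0).nonempty
  obtain ⟨y, hyO, hyE⟩ : ∃ y ∈ O, y ∉ closure E := by
    by_contra! hcon
    have : (⟨_, (0, k), rfl⟩ : Set.range (cubePoint A)) ∈ interior (closure E) :=
      interior_maximal hcon hO (mem_boolCyl_iff.1 hk)
    rw [hE] at this
    exact this
  obtain ⟨V, hV, hVE⟩ := isOpen_induced_iff.1 (isClosed_closure (s := E)).isOpen_compl
  have hyV : y.1 ∈ V := by
    change y ∈ Subtype.val ⁻¹' V
    rw [hVE]
    exact hyE
  obtain ⟨I, hI⟩ := exists_finset_agree_subset hV hyV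
  refine ⟨u ∪ I.image fun i ↦ (i, y.1 i), consistent_of_forall_eq (g := y.1) fun q hq ↦ ?_,
    Finset.subset_union_left, Set.disjoint_left.2 fun p hp hpE ↦ ?_⟩
  · rcases Finset.mem_union.1 hq with hq | hq
    · exact hyO q hq
    · obtain ⟨i, -, rfl⟩ := Finset.mem_image.1 hq
      rfl
  · have hpV : (⟨_, p, rfl⟩ : Set.range (cubePoint A)) ∈ Subtype.val ⁻¹' V := hI _ fun i hi ↦
      mem_boolCyl_iff.1 hp _ (Finset.mem_union_right _ (Finset.mem_image_of_mem _ hi))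
    rw [hVE] at hpV
    exact hpV (subset_closure hpE)

theorem not_nwdSeparable_range_cubePoint [LinearOrder W] [WellFoundedLT W] [Nonempty W]
    (hW : ∀ β : W, (Set.Iio β).Countable) (hb : ∀ s : Set W, s.Countable → ∃ β, ∀ γ ∈ s, γ < β)
    {A : W → Set (ℕ × ℕ)} (hA : ∀ u, Consistent u → ∀ n, {k | (n, k) ∈ boolCyl A u}.Infinite)
    (hA' : ∀ α (E : ℕ → Set (ℕ × ℕ)), (∀ n, NwdBelow A α (E n)) →
      ∃ β, ∀ n k, (n, k) ∈ A β → (n, k) ∉ E n) :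
    ¬ NWDSeparable (Set.range (cubePoint A)) := by
  classical
  intro hsep
  let pt : ℕ × ℕ → Set.range (cubePoint A) := fun p ↦ ⟨_, p, rfl⟩
  obtain ⟨E, hE, hdense⟩ := hsep (fun n ↦ Set.range fun k ↦ pt (n, k)) fun n ↦ by
    refine Subtype.dense_iff.2 fun x _ ↦ ?_
    have := dense_cubePoint_column hA n x
    rwa [← Set.range_comp]
  have hnwd : ∀ n u, ∃ v, Consistent u →
      Consistent v ∧ u ⊆ v ∧ Disjoint (boolCyl A v) (pt ⁻¹' E n) := by
    intro n u
    by_cases hu : Consistent u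
    · obtain ⟨v, hv⟩ := exists_disjoint_boolCyl hA (hE n).2 hu
      exact ⟨v, fun _ ↦ hv⟩
    · exact ⟨∅, fun h ↦ absurd h hu⟩
  choose f hf using hnwd
  obtain ⟨α, hα⟩ := exists_closed_below hW hb f
  obtain ⟨β, hβ⟩ := hA' α (fun n ↦ pt ⁻¹' E n) fun n u ↦
    ⟨⟨f n u.1, (hf n u.1 u.2.1).1, hα n u.1 u.2.1 u.2.2⟩, (hf n u.1 u.2.1).2.1,
      (hf n u.1 u.2.1).2.2⟩
  -- This open set contains a point but misses every `E n`, contradicting density of the union.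
  have hO : IsOpen {y : Set.range (cubePoint A) | y.1 β = true} :=
    (isOpen_discrete ({true} : Set Bool)).preimage
      ((continuous_apply (A := fun _ : W ↦ Bool) β).comp continuous_subtype_val)
  obtain ⟨k, hk⟩ := (hA {(β, true)} (by intro α; simp) 0).nonempty
  have hk' := mem_boolCyl_iff.1 hk (β, true) (Finset.mem_singleton_self _)
  obtain ⟨y, hy, hyE⟩ := hdense.inter_open_nonempty _ hO ⟨pt (0, k), hk'⟩
  obtain ⟨n, hn⟩ := Set.mem_iUnion.1 hyE
  obtain ⟨m, rfl⟩ := (hE n).1 hn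
  exact hβ n m (cubePoint_eq_true.1 hy) hn

end Points

/-! ### Comparison of D-separability with NWD-separability. -/

theorem Dense.not_isOpen_singleton_cube {W : Type*} [Infinite W] {X : Set (W → Bool)}
    (hX : Dense X) (x : X) : ¬ IsOpen ({x} : Set X) := by
  intro h
  obtain ⟨V, hV, hVx⟩ := isOpen_induced_iff.1 h
  have hxV : x.1 ∈ V := by
    change x ∈ Subtype.val ⁻¹' V
    rw [hVx]
    rfl
  obtain ⟨I, hI⟩ := exists_finset_agree_subset hV hxV
  obtain ⟨β, hβ⟩ := Infinite.exists_notMem_finset I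
  classical
  have hO : IsOpen (V ∩ (fun g : W → Bool ↦ g β) ⁻¹' {!x.1 β}) :=
    hV.inter ((isOpen_discrete _).preimage (continuous_apply β))
  obtain ⟨y, ⟨hyV, hyβ⟩, hyX⟩ := hX.inter_open_nonempty _ hO
    ⟨Function.update x.1 β (!x.1 β), hI _ fun i hi ↦
      Function.update_of_ne (ne_of_mem_of_not_mem hi hβ) _ _, by simp⟩
  have : (⟨y, hyX⟩ : X) ∈ ({x} : Set X) := by
    rw [← hVx]
    exact hyV
  obtain rfl : y = x.1 := congrArg Subtype.val this
  simp at hyβ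

theorem IsDiscrete.isNowhereDense_of_not_isOpen_singleton {X : Type*} [TopologicalSpace X]
    [T1Space X] (h : ∀ x : X, ¬ IsOpen ({x} : Set X)) {s : Set X} (hs : IsDiscrete s) :
    IsNowhereDense s := by
  refine Set.eq_empty_iff_forall_notMem.2 fun x hx ↦ ?_
  obtain ⟨y, hy, hys⟩ := mem_closure_iff.1 (interior_subset hx) _ isOpen_interior hx
  obtain ⟨V, hV, hVs⟩ := isDiscrete_iff_forall_mem_exists_isOpen.1 hs y hys
  have hyV : y ∈ V := (hVs.symm ▸ Set.mem_singleton y : y ∈ V ∩ s).1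
  refine h y ?_
  -- A second point `z` here would, after removing the closed point `y`, give an open set meeting
  -- `s` inside `V`, although `V ∩ s = {y}`.
  have hO : IsOpen (V ∩ interior (closure s)) := hV.inter isOpen_interior
  convert! hO
  refine (Set.Subset.antisymm ?_ ?_)
  · rintro _ rfl
    exact ⟨hyV, hy⟩
  · rintro z ⟨hzV, hz⟩
    by_contra hzy
    obtain ⟨w, ⟨⟨hwV, -⟩, hwy⟩, hws⟩ := mem_closure_iff.1 (interior_subset hz) _
      (hO.inter (isOpen_compl_singleton (x := y))) ⟨⟨hzV, hz⟩, hzy⟩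
    exact hwy (hVs ▸ (⟨hwV, hws⟩ : w ∈ V ∩ s))

theorem DSeparable.nwdSeparable {X : Type*} [TopologicalSpace X] [T1Space X]
    (h : ∀ x : X, ¬ IsOpen ({x} : Set X)) (hX : DSeparable X) : NWDSeparable X := fun D hD ↦ by
  obtain ⟨E, hE, hd⟩ := hX D hD
  exact ⟨E, fun n ↦ ⟨(hE n).1, (hE n).2.isNowhereDense_of_not_isOpen_singleton h⟩, hd⟩

/-- One point of `D n` in the `n`-th basic open set suffices. -/
theorem DSeparable.of_secondCountable (X : Type*) [TopologicalSpace X]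
    [SecondCountableTopology X] : DSeparable X := fun D hD ↦ by
  obtain ⟨s, hsc, hs0, hs⟩ := TopologicalSpace.exists_countable_basis X
  rcases s.eq_empty_or_nonempty with rfl | hne
  · refine ⟨fun _ ↦ ∅, fun n ↦ ⟨Set.empty_subset _, Set.subsingleton_empty.isDiscrete⟩, fun x ↦ ?_⟩
    obtain ⟨v, hv, -⟩ := hs.exists_subset_of_mem_open (Set.mem_univ x) isOpen_univ
    exact absurd hv (Set.notMem_empty _)
  obtain ⟨U, rfl⟩ := hsc.exists_eq_range hne
  have hU : ∀ n, (U n ∩ D n).Nonempty := fun n ↦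
    (hD n).inter_open_nonempty _ (hs.isOpen ⟨n, rfl⟩)
      (Set.nonempty_iff_ne_empty.2 fun h ↦ hs0 ⟨n, h⟩)
  choose e he using hU
  refine ⟨fun n ↦ {e n}, fun n ↦ ⟨Set.singleton_subset_iff.2 (he n).2,
    Set.subsingleton_singleton.isDiscrete⟩, hs.dense_iff.2 ?_⟩
  rintro _ ⟨n, rfl⟩ -
  exact ⟨e n, (he n).1, Set.mem_iUnion.2 ⟨n, rfl⟩⟩

/-! ### Combinatorics of ω₁ and the value of cds. -/

theorem aleph_one_le_of_mem_cdsSet {κ : Cardinal} (h : κ ∈ cdsSet) : ℵ₁ ≤ κ := by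
  obtain ⟨I, rfl, X, -, hX⟩ := h
  by_contra! hlt
  have hle : #I ≤ ℵ₀ := by rwa [← Cardinal.succ_aleph0, Order.lt_succ_iff] at hlt
  have : Countable I := Cardinal.mk_le_aleph0_iff.1 hle
  exact hX (DSeparable.of_secondCountable X)

theorem countable_Iio_omega_one (β : (ω₁ : Ordinal.{0}).ToType) : (Set.Iio β).Countable := by
  have h := mk_Iio_lt β (by rw [mk_toType, Ordinal.type_toType, card_omega, ord_aleph])
  rw [mk_toType, card_omega, ← Cardinal.succ_aleph0, Order.lt_succ_iff] at h
  exact Cardinal.le_aleph0_iff_set_countable.1 h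

theorem not_countable_omega_one : ¬ Countable (ω₁ : Ordinal.{0}).ToType := by
  rw [← Cardinal.mk_le_aleph0_iff, mk_toType, card_omega, not_le]
  exact Cardinal.aleph0_lt_aleph_one

theorem exists_forall_lt_omega_one {s : Set (ω₁ : Ordinal.{0}).ToType} (hs : s.Countable) :
    ∃ β, ∀ γ ∈ s, γ < β := by
  by_contra! hcon
  refine not_countable_omega_one (Set.countable_univ_iff.1 ?_)
  refine (hs.biUnion fun γ _ ↦ (countable_Iio_omega_one γ).union
    (Set.countable_singleton γ)).mono fun β _ ↦ ?_
  obtain ⟨γ, hγ, hβ⟩ := hcon β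
  exact Set.mem_biUnion hγ (hβ.lt_or_eq.imp id id)

theorem exists_bookkeeping_omega_one (K : Type) [Nonempty K] (hK : #K ≤ ℵ₁) :
    ∃ φ : (ω₁ : Ordinal.{0}).ToType → (ω₁ : Ordinal.{0}).ToType × K,
      ∀ α j, ∃ β ≥ α, φ β = (α, j) := by
  set W := (ω₁ : Ordinal.{0}).ToType
  have hW : #W = ℵ₁ := by rw [mk_toType, card_omega]
  have hinf : ℵ₀ ≤ #W := by rw [hW]; exact Cardinal.aleph0_lt_aleph_one.le
  -- The extra factor `W` repeats each pair uncountably often, so not all its occurrences fit in the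
  -- countable segment below `α`.
  have hcard : #(W × (W × K)) = #W := by
    simp only [mk_prod, Cardinal.lift_id]
    rw [
      Cardinal.mul_eq_left (b := #K) hinf (hK.trans hW.ge) (Cardinal.mk_ne_zero K),
      Cardinal.mul_eq_self hinf]
  obtain ⟨e⟩ := Cardinal.eq.1 hcard
  refine ⟨fun β ↦ (e.symm β).2, fun α j ↦ ?_⟩
  by_contra! hcon
  refine not_countable_omega_one (Set.countable_univ_iff.1 ?_)
  have hinj : Function.Injective fun w : W ↦ e (w, α, j) := fun w w' h ↦
    (Prod.mk.inj (e.injective h)).1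
  refine ((countable_Iio_omega_one α).preimage_of_injOn hinj.injOn).mono fun w _ ↦ ?_
  by_contra hw
  exact hcon (e (w, α, j)) (not_lt.1 hw) (by simp)

theorem mainTheorem5 (h : cofMeagre = ℵ₁) :
    (∃ X : Set ((ω₁ : Ordinal.{0}).ToType → Bool),
      X.Countable ∧ Dense X ∧ ¬ NWDSeparable X) ∧
    cds = ℵ₁ ∧
    (ℵ₁ < 𝔠 → cds < 𝔠) := by
  have hW : #(ω₁ : Ordinal.{0}).ToType = ℵ₁ := by rw [mk_toType, card_omega]
  have hinf : Infinite (ω₁ : Ordinal.{0}).ToType :=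
    Cardinal.infinite_iff.2 (by rw [hW]; exact Cardinal.aleph0_lt_aleph_one.le)
  have hX : ∃ X : Set ((ω₁ : Ordinal.{0}).ToType → Bool),
      X.Countable ∧ Dense X ∧ ¬ NWDSeparable X := by
    obtain ⟨M, hM⟩ := exists_isMeagreBase (h.trans hW.symm)
    obtain ⟨φ, hφ⟩ := exists_bookkeeping_omega_one
      ((ω₁ : Ordinal.{0}).ToType × (ω₁ : Ordinal.{0}).ToType × ℕ × ℕ) (by
        simp only [mk_prod, Cardinal.lift_id, hW, mk_nat, aleph0_mul_aleph0]
        rw [Cardinal.mul_eq_left (b := ℵ₀) Cardinal.aleph0_lt_aleph_one.le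
          Cardinal.aleph0_lt_aleph_one.le Cardinal.aleph0_ne_zero,
          Cardinal.mul_eq_self Cardinal.aleph0_lt_aleph_one.le])
    obtain ⟨A, hA, hA'⟩ := exists_independent_family countable_Iio_omega_one hM hφ
    exact ⟨Set.range (cubePoint A), Set.countable_range _,
      (dense_cubePoint_column hA 0).mono (Set.range_comp_subset_range _ _),
      not_nwdSeparable_range_cubePoint countable_Iio_omega_one
        (fun _ ↦ exists_forall_lt_omega_one) hA hA'⟩
  have hcds : cds = ℵ₁ := by
    obtain ⟨X, hXc, hXd, hXn⟩ := hX
    have hmem : ℵ₁ ∈ cdsSet := ⟨_, hW, X, hXc, fun hD ↦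
      hXn (hD.nwdSeparable hXd.not_isOpen_singleton_cube)⟩
    exact le_antisymm (csInf_le' hmem) (aleph_one_le_of_mem_cdsSet (csInf_mem ⟨_, hmem⟩))
  refine ⟨hX, hcds, fun hc ↦ ?_⟩
  rw [hcds]
  have h1 : Cardinal.lift.{_, 0} ℵ₁ = ℵ₁ := by rw [Cardinal.lift_aleph, Ordinal.lift_one]
  rwa [← Cardinal.lift_continuum.{_, 0}, ← h1, Cardinal.lift_lt] at hc
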